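/- Let $p:\mathbb{N}\to(0,1]$ and let $\varepsilon_{N,i,j}$, $(N,i,j)\in\mathbb{N}^3$, be independent $\{0,1\}$-valued random variables on a product probability space with law $\mathbb{P}_\varepsilon$, where $\mathbb{P}_\varepsilon(\varepsilon_{N,i,j}=1)=p(N)$ (the indicators of the directed edges, self-loops included, of a sequence of directed Erdős–Rényi graphs). For $\beta\in\mathbb{R}$, let the Curie–Weiss measure $\mathbb{P}_N^{(CW)}$ and, for each graph realisation, the Bovier–Gayrard measure $\mathbb{P}_N^{(BG)}$ be the probability measures on $\mathcal{X}_N=\{-1,+1\}^N$ that give $\mathbf{x}=(x_1,\dots,x_N)$ a probability proportional to $$\exp\Big(\frac{\beta}{2N}\sum_{i,j=1}^N x_ix_j\Big)\quad\text{and}\quad \exp\Big(\frac{\beta}{2Np(N)}\sum_{i,j=1}^N\varepsilon_{N,i,j}\,x_ix_j\Big),$$ respectively. **Theorem.** Let $\beta<1$ and $Np(N)\to\infty$ as $N\to\infty$. Let $d\in\mathbb{N}$, let $Y_N:\mathcal{X}_N\to\mathbb{R}^d$ be arbitrary maps, and let $\mathbb{P}_Y$ be a probability measure on $\mathbb{R}^d$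 such that the image laws $\mathbb{P}_N^{(CW)}\circ Y_N^{-1}$ converge weakly to $\mathbb{P}_Y$ as $N\to\infty$. Then $$d_L\big(\mathbb{P}_N^{(BG)}\circ Y_N^{-1},\ \mathbb{P}_Y\big)\longrightarrow 0\quad\text{in } \mathbb{P}_\varepsilon\text{-probability as } N\to\infty,$$ both when $d_L$ is the Lévy–Prokhorov metric on the probability measures on $\mathbb{R}^d$ (with the Euclidean norm) and when $d_L$ is the Lévy metric $$d_L(\mu,\nu)=\inf\{\epsilon>0:\ F_\mu(x-\epsilon\mathbf{1})-\epsilon\le F_\nu(x)\le F_\mu(x+\epsilon\mathbf{1})+\epsilon\ \text{ for all } x\in\mathbb{R}^d\}$$ of the distribution functions $F_\mu(x)=\mu\{y: y_i\le x_i \text{ for all } i\}$, where $\mathbf{1}=(1,\dots,1)$. -/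

import Mathlib

open MeasureTheory ProbabilityTheory Filter Topology

namespace CurieWeiss

/-- Spin configurations `{-1, +1}^N`; the two-element group `ℤˣ` is `{1, -1}`. -/
abbrev Config (N : ℕ) : Type := Fin N → ℤˣ

/-- A spin as a real number. -/
def spin (s : ℤˣ) : ℝ := ((s : ℤ) : ℝ)

/-- Realisations of the whole sequence of directed graphs: the coordinate `(N, i, j)` is `true`
iff the `N`-th graph has a directed edge from `i` to `j` (self-loops are allowed). -/
abbrev GraphSeq : Type := ℕ × ℕ × ℕ → Bool

/-- The law of the graph sequence: all edge indicators are independent, and those of the `N`-th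
graph are Bernoulli with parameter `p N`. -/
noncomputable def graphLaw (p : ℕ → unitInterval) : Measure GraphSeq :=
  Measure.infinitePi fun e : ℕ × ℕ × ℕ => bernoulliMeasure true false (p e.1)

/-- The edge indicator, with values in `{0, 1}`, between two nodes of the `N`-th graph. -/
def edge (ω : GraphSeq) (N : ℕ) (i j : Fin N) : ℝ :=
  if ω (N, (i : ℕ), (j : ℕ)) then 1 else 0

/-- The exponent `β / (2N) ∑ x_i x_j` of the Curie-Weiss model. -/
noncomputable def exponentCW (β : ℝ) (N : ℕ) (x : Config N) : ℝ :=
  β / (2 * (N : ℝ)) * ∑ i, ∑ j, spin (x i) * spin (x j)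

/-- The exponent `β / (2Np) ∑ ε_{N,i,j} x_i x_j` of the Bovier-Gayrard model. -/
noncomputable def exponentBG (β : ℝ) (p : ℕ → unitInterval) (ω : GraphSeq) (N : ℕ)
    (x : Config N) : ℝ :=
  β / (2 * (N : ℝ) * (p N : ℝ)) * ∑ i, ∑ j, edge ω N i j * spin (x i) * spin (x j)

/-- The probability distribution on configurations that is proportional to `exp (H x)`. -/
noncomputable def gibbs {N : ℕ} (H : Config N → ℝ) : PMF (Config N) :=
  PMF.ofFintype (fun x => ENNReal.ofReal (Real.exp (H x) / ∑ y, Real.exp (H y))) <| by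
    have hpos : 0 < ∑ y, Real.exp (H y) :=
      Finset.sum_pos (fun y _ => Real.exp_pos _) Finset.univ_nonempty
    rw [← ENNReal.ofReal_sum_of_nonneg fun x _ => (div_pos (Real.exp_pos _) hpos).le,
      ← Finset.sum_div, div_self hpos.ne', ENNReal.ofReal_one]

/-- The image law on `ℝ^d` of a random vector defined on random configurations. -/
noncomputable def imageLaw {N d : ℕ} (P : PMF (Config N))
    (Y : Config N → EuclideanSpace ℝ (Fin d)) : ProbabilityMeasure (EuclideanSpace ℝ (Fin d)) :=
  ⟨(P.map Y).toMeasure, inferInstance⟩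

/-- The image law of `Y` under the Curie-Weiss measure. -/
noncomputable def lawCW (β : ℝ) {N d : ℕ} (Y : Config N → EuclideanSpace ℝ (Fin d)) :
    ProbabilityMeasure (EuclideanSpace ℝ (Fin d)) :=
  imageLaw (gibbs (exponentCW β N)) Y

/-- The image law of `Y` under the Bovier-Gayrard measure of the graph realisation `ω`. -/
noncomputable def lawBG (β : ℝ) (p : ℕ → unitInterval) (ω : GraphSeq) {N d : ℕ}
    (Y : Config N → EuclideanSpace ℝ (Fin d)) :
    ProbabilityMeasure (EuclideanSpace ℝ (Fin d)) :=
  imageLaw (gibbs (exponentBG β p ω N)) Y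

/-- The distribution function, shifted along the diagonal: `μ {y | y_i ≤ x_i + t for all i}`. -/
noncomputable def shiftedCDF {d : ℕ} (μ : Measure (EuclideanSpace ℝ (Fin d)))
    (x : EuclideanSpace ℝ (Fin d)) (t : ℝ) : ℝ :=
  μ.real {y | ∀ i, y i ≤ x i + t}

/-- The Lévy distance of two laws on `ℝ^d`, defined through their distribution functions `F`, `G`:
the infimum of the `ε > 0` with `F (x - ε𝟙) - ε ≤ G x ≤ F (x + ε𝟙) + ε` for all `x`. -/
noncomputable def levyDist {d : ℕ} (μ ν : Measure (EuclideanSpace ℝ (Fin d))) : ℝ :=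
  sInf {ε : ℝ | 0 < ε ∧ ∀ x : EuclideanSpace ℝ (Fin d),
    shiftedCDF μ x (-ε) - ε ≤ shiftedCDF ν x 0 ∧ shiftedCDF ν x 0 ≤ shiftedCDF μ x ε + ε}

end CurieWeiss

/-!
The exponent of the Bovier-Gayrard model is treated by a second-moment method, after a factor that
the Gibbs measure does not see has been removed. Let `t = β / (2Np)` and `τ = tanh t`. For an edge
indicator `ε ∈ {0, 1}` and a sign `s = x_i x_j`,
`exp (t ε s) = (1 + ε (cosh t - 1)) (1 + ε s τ)`,
and the first factor does not depend on the configuration (`exists_exp_exponentBG_eq`). This factor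
is what makes the partition function fluctuate wildly for small `p`; once it is gone, the remaining
product, divided by the Curie-Weiss exponential, is a random density `g x` (`relDensity`) whose
first two moments are explicit products over the `N²` independent edges. Expanding their logarithms
to second order gives
`|𝔼 (g x) - 1|, |𝔼 (g x * g y) - 1| ≤ exp (δ_N G (x, y)) - 1`,
where `G (x, y) = 1 + (S(x)² + S(y)² + S(xy)²) / N`, `S` is the total magnetization, and `δ_N → 0`
because `Np → ∞` (`abs_first_moment_sub_one_le`, `abs_second_moment_sub_one_le`,
`tendsto_momentRate`). As `β < 1`, some exponential moment of `G` under two independent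
Curie-Weiss configurations is bounded in `N`, by linearisation of the squares with a Gaussian
integral (`exists_sum_exp_overlapSum_le`). Hence the moments of `g` tend to `1` on Curie-Weiss
average (`tendsto_momentDefect_relDensity`), and Chebyshev's inequality, applied to the numerator
and the denominator of a Gibbs average, shows that Bovier-Gayrard and Curie-Weiss averages of
uniformly bounded functions differ by a quantity that tends to `0` in probability
(`measure_le_abs_weighted_average_sub_le`).

For laws on `ℝ^d` this means that the integral of every bounded continuous function converges in
probability. The sets that contain the random laws with probability tending to `1` form a filter,
so this already gives convergence in probability for the weak topology (`inProbability_le_nhds`).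
The Lévy-Prokhorov metric induces that topology, and the Lévy metric is at most the Lévy-Prokhorov
metric (`levyDist_le_levyProkhorovDist`).
-/

namespace CurieWeiss

/-! ### Convergence in probability along a filter -/

/-- The filter of the sets `U` with `P (X N ∉ U) → 0`. Closure under intersections is the union
bound; no measurability is needed, as `P` stands for the outer measure. -/
def inProbability {Ω E : Type*} [MeasurableSpace Ω] (P : Measure Ω) (X : ℕ → Ω → E) :
    Filter E where
  sets := {U | Tendsto (fun N => P {ω | X N ω ∉ U}) atTop (𝓝 0)}
  univ_sets := by simp
  sets_of_superset {U V} hU hUV :=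
    tendsto_of_tendsto_of_tendsto_of_le_of_le tendsto_const_nhds hU (fun _ => zero_le)
      fun N => measure_mono fun _ h h' => h (hUV h')
  inter_sets {U V} hU hV := by
    have h : Tendsto (fun N => P {ω | X N ω ∉ U} + P {ω | X N ω ∉ V}) atTop (𝓝 0) := by
      simpa using Tendsto.add hU hV
    refine tendsto_of_tendsto_of_tendsto_of_le_of_le tendsto_const_nhds h (fun _ => zero_le)
      fun N => (measure_mono fun ω hω => ?_).trans (measure_union_le _ _)
    by_cases hωU : X N ω ∈ U
    · exact Or.inr fun hωV => hω ⟨hωU, hωV⟩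
    · exact Or.inl hωU

/-- A real function of `X N` converges in probability iff it converges along the filter, so
statements on limits along arbitrary filters apply to convergence in probability. -/
theorem tendsto_inProbability_iff {Ω E : Type*} [MeasurableSpace Ω] {P : Measure Ω}
    {X : ℕ → Ω → E} {g : E → ℝ} {c : ℝ} :
    Tendsto g (inProbability P X) (𝓝 c) ↔
      TendstoInMeasure P (fun N ω => g (X N ω)) atTop (fun _ => c) := by
  rw [tendstoInMeasure_iff_dist, Metric.tendsto_nhds]
  refine forall₂_congr fun ε _ => ?_
  change Tendsto (fun N => P {ω | ¬ dist (g (X N ω)) c < ε}) atTop (𝓝 0) ↔ _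
  simp only [not_lt]

/-- Convergence in probability of the integrals of each bounded continuous function implies
convergence in probability in the weak topology. -/
theorem inProbability_le_nhds {Ω E : Type*} [MeasurableSpace Ω] {P : Measure Ω}
    [TopologicalSpace E] [MeasurableSpace E] [OpensMeasurableSpace E]
    {X : ℕ → Ω → ProbabilityMeasure E} {Q : ProbabilityMeasure E}
    (h : ∀ f : BoundedContinuousFunction E ℝ,
      TendstoInMeasure P (fun N ω => ∫ y, f y ∂(X N ω : Measure E)) atTop
        (fun _ => ∫ y, f y ∂(Q : Measure E))) :
    inProbability P X ≤ 𝓝 Q := by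
  have : Tendsto id (inProbability P X) (𝓝 Q) :=
    ProbabilityMeasure.tendsto_iff_forall_integral_tendsto.2 fun f =>
      (tendsto_inProbability_iff (g := fun μ : ProbabilityMeasure E =>
        ∫ y, f y ∂(μ : Measure E))).2 (h f)
  exact this

theorem tendsto_levyProkhorovDist_nhds {E : Type*} [PseudoMetricSpace E]
    [TopologicalSpace.SeparableSpace E] [MeasurableSpace E] [BorelSpace E]
    (Q : ProbabilityMeasure E) :
    Tendsto (fun μ : ProbabilityMeasure E =>
      levyProkhorovDist (μ : Measure E) (Q : Measure E)) (𝓝 Q) (𝓝 0) := by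
  have h := ((LevyProkhorov.probabilityMeasureHomeomorph (Ω := E)).continuous.tendsto Q)
  rw [tendsto_iff_dist_tendsto_zero] at h
  exact h

/-! ### The Lévy metric is dominated by the Lévy-Prokhorov metric -/

theorem levyDist_nonneg {d : ℕ} (μ ν : Measure (EuclideanSpace ℝ (Fin d))) :
    0 ≤ levyDist μ ν :=
  Real.sInf_nonneg fun _ h => h.1.le

theorem measurableSet_lowerOrthant {d : ℕ} (x : EuclideanSpace ℝ (Fin d)) (t : ℝ) :
    MeasurableSet {y : EuclideanSpace ℝ (Fin d) | ∀ i, y i ≤ x i + t} := by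
  have : {y : EuclideanSpace ℝ (Fin d) | ∀ i, y i ≤ x i + t} =
      ⋂ i, {y : EuclideanSpace ℝ (Fin d) | y i ≤ x i + t} := by ext; simp
  rw [this]
  exact (isClosed_iInter fun i => isClosed_le (by fun_prop) (by fun_prop)).measurableSet

/-- The Euclidean `ε`-thickening of a lower orthant lies in the orthant shifted by `ε` along the
diagonal, since a coordinate is at most the Euclidean norm. -/
theorem shiftedCDF_le_of_measure_le {d : ℕ} {μ ν : Measure (EuclideanSpace ℝ (Fin d))}
    [IsProbabilityMeasure μ] [IsProbabilityMeasure ν] {ε : ℝ} (hε : 0 < ε)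
    (h : ∀ B : Set (EuclideanSpace ℝ (Fin d)), MeasurableSet B →
      μ B ≤ ν (Metric.thickening ε B) + ENNReal.ofReal ε)
    (x : EuclideanSpace ℝ (Fin d)) (t : ℝ) :
    shiftedCDF μ x t ≤ shiftedCDF ν x (t + ε) + ε := by
  have hsub : Metric.thickening ε {y : EuclideanSpace ℝ (Fin d) | ∀ i, y i ≤ x i + t} ⊆
      {y | ∀ i, y i ≤ x i + (t + ε)} := by
    intro y hy i
    obtain ⟨z, hz, hyz⟩ := Metric.mem_thickening_iff.1 hy
    have h1 : |y i - z i| ≤ dist y z := by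
      rw [dist_eq_norm]
      simpa using PiLp.norm_apply_le (y - z) i
    have h2 := hz i
    have h3 := le_abs_self (y i - z i)
    linarith
  have h1 := (h _ (measurableSet_lowerOrthant x t)).trans
    (add_le_add (measure_mono hsub) le_rfl)
  have h2 := ENNReal.toReal_mono (by finiteness) h1
  rw [ENNReal.toReal_add (by finiteness) (by finiteness), ENNReal.toReal_ofReal hε.le] at h2
  exact h2

theorem levyDist_le_levyProkhorovDist {d : ℕ} (μ ν : Measure (EuclideanSpace ℝ (Fin d)))
    [IsProbabilityMeasure μ] [IsProbabilityMeasure ν] :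
    levyDist μ ν ≤ levyProkhorovDist μ ν := by
  refine le_of_forall_gt_imp_ge_of_dense fun ε hε => ?_
  have hε0 : 0 < ε := lt_of_le_of_lt ENNReal.toReal_nonneg hε
  have hlt : levyProkhorovEDist μ ν < ENNReal.ofReal ε :=
    (ENNReal.lt_ofReal_iff_toReal_lt (levyProkhorovEDist_ne_top μ ν)).2 hε
  refine csInf_le ⟨0, fun _ h => h.1.le⟩ ⟨hε0, fun x => ⟨?_, ?_⟩⟩
  · have := shiftedCDF_le_of_measure_le (μ := μ) (ν := ν) hε0 (fun B hB => by
      simpa [ENNReal.toReal_ofReal hε0.le] using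
        left_measure_le_of_levyProkhorovEDist_lt hlt hB) x (-ε)
    rw [neg_add_cancel] at this
    linarith
  · have := shiftedCDF_le_of_measure_le (μ := ν) (ν := μ) hε0 (fun B hB => by
      simpa [ENNReal.toReal_ofReal hε0.le] using
        right_measure_le_of_levyProkhorovEDist_lt hlt hB) x 0
    rwa [zero_add] at this

theorem tendsto_levyDist_nhds {d : ℕ} (Q : ProbabilityMeasure (EuclideanSpace ℝ (Fin d))) :
    Tendsto (fun μ : ProbabilityMeasure (EuclideanSpace ℝ (Fin d)) =>
      levyDist (μ : Measure (EuclideanSpace ℝ (Fin d))) Q) (𝓝 Q) (𝓝 0) :=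
  squeeze_zero (fun _ => levyDist_nonneg _ _) (fun _ => levyDist_le_levyProkhorovDist _ _)
    (tendsto_levyProkhorovDist_nhds Q)

/-! ### Integrals with respect to image laws of Gibbs measures -/

theorem integral_imageLaw_gibbs {N d : ℕ} (H : Config N → ℝ)
    (Y : Config N → EuclideanSpace ℝ (Fin d)) {f : EuclideanSpace ℝ (Fin d) → ℝ}
    (hf : Continuous f) :
    ∫ y, f y ∂(imageLaw (gibbs H) Y : Measure (EuclideanSpace ℝ (Fin d))) =
      (∑ x, f (Y x) * Real.exp (H x)) / ∑ x, Real.exp (H x) := by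
  let _ : MeasurableSpace (Config N) := ⊤
  have hY : Measurable Y := measurable_from_top
  change ∫ y, f y ∂((gibbs H).map Y).toMeasure = _
  rw [← PMF.toMeasure_map Y (gibbs H) hY, integral_map hY.aemeasurable hf.aestronglyMeasurable,
    PMF.integral_eq_sum, Finset.sum_div]
  refine Finset.sum_congr rfl fun x _ => ?_
  have hpos : 0 ≤ Real.exp (H x) / ∑ y, Real.exp (H y) := by positivity
  rw [gibbs, PMF.ofFintype_apply, ENNReal.toReal_ofReal hpos, smul_eq_mul]
  ring

/-! ### Expectations over the random graphs -/

instance isProbabilityMeasure_graphLaw (p : ℕ → unitInterval) :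
    IsProbabilityMeasure (graphLaw p) := by
  unfold graphLaw; infer_instance

theorem measurable_edge (N : ℕ) (i j : Fin N) : Measurable fun ω : GraphSeq => edge ω N i j := by
  have h : Measurable fun b : Bool => if b then (1 : ℝ) else 0 := measurable_from_top
  exact h.comp (measurable_pi_apply (N, (i : ℕ), (j : ℕ)))

theorem edge_eq_zero_or_one (ω : GraphSeq) (N : ℕ) (i j : Fin N) :
    edge ω N i j = 0 ∨ edge ω N i j = 1 := by
  unfold edge; split_ifs <;> simp

theorem integral_prod_edge (p : ℕ → unitInterval) (N : ℕ) (φ : Fin N × Fin N → ℝ → ℝ) :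
    ∫ ω, ∏ e, φ e (edge ω N e.1 e.2) ∂graphLaw p =
      ∏ e, ((p N : ℝ) * φ e 1 + (1 - p N) * φ e 0) := by
  have hind : iIndepFun (fun (e : ℕ × ℕ × ℕ) (ω : GraphSeq) => ω e) (graphLaw p) :=
    iIndepFun_infinitePi (X := fun _ b => b) fun _ => measurable_id
  have hinj : Function.Injective fun e : Fin N × Fin N => (N, (e.1 : ℕ), (e.2 : ℕ)) := by
    rintro ⟨i, j⟩ ⟨k, l⟩ h
    simpa [Fin.ext_iff] using h
  have h := (hind.precomp hinj).integral_fun_prod_comp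
    (f := fun e b => φ e (if b then (1 : ℝ) else 0))
    (fun e => (measurable_pi_apply _).aemeasurable)
    (fun e => (measurable_from_top : Measurable _).aestronglyMeasurable)
  refine h.trans (Finset.prod_congr rfl fun e _ => ?_)
  have hm : (graphLaw p).map (fun ω => ω (N, (e.1 : ℕ), (e.2 : ℕ))) =
      bernoulliMeasure true false (p N) := Measure.infinitePi_map_eval _ _
  have hi := integral_map (μ := graphLaw p) (φ := fun ω => ω (N, (e.1 : ℕ), (e.2 : ℕ)))
    (f := fun b : Bool => φ e (if b then (1 : ℝ) else 0))
    (measurable_pi_apply _).aemeasurable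
    (measurable_from_top : Measurable _).aestronglyMeasurable
  refine hi.symm.trans ?_
  rw [hm, integral_bernoulliMeasure]
  simp

theorem integrable_prod_edge (p : ℕ → unitInterval) (N : ℕ) (φ : Fin N × Fin N → ℝ → ℝ)
    (hφ : ∀ e, Measurable (φ e)) :
    Integrable (fun ω => ∏ e, φ e (edge ω N e.1 e.2)) (graphLaw p) := by
  refine Integrable.of_bound (C := ∏ e, (|φ e 0| + |φ e 1|)) ?_ (.of_forall fun ω => ?_)
  · exact (Finset.measurable_fun_prod _ fun e _ =>
      (hφ e).comp (measurable_edge N e.1 e.2)).aestronglyMeasurable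
  · rw [Real.norm_eq_abs, Finset.abs_prod]
    refine Finset.prod_le_prod (fun _ _ => abs_nonneg _) fun e _ => ?_
    rcases edge_eq_zero_or_one ω N e.1 e.2 with h | h <;> rw [h]
    · exact le_add_of_nonneg_right (abs_nonneg _)
    · exact le_add_of_nonneg_left (abs_nonneg _)

/-! ### Random reweightings of a finite probability space -/

section Reweighting

variable {Ω X : Type*} [MeasurableSpace Ω] [Fintype X] {P : Measure Ω} [IsProbabilityMeasure P]
  {w : X → ℝ} {g : X → Ω → ℝ}

/-- How far the first two moments of the random densities `g` are from `1`, on `w`-average. -/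
noncomputable def momentDefect (P : Measure Ω) (w : X → ℝ) (g : X → Ω → ℝ) : ℝ :=
  ∑ x, ∑ y, w x * w y *
    (|∫ ω, g x ω * g y ω ∂P - 1| + |∫ ω, g x ω ∂P - 1| + |∫ ω, g y ω ∂P - 1|)

theorem integrable_sq_weighted_sum (hg : ∀ x, Integrable (g x) P)
    (hgg : ∀ x y, Integrable (fun ω => g x ω * g y ω) P) (f : X → ℝ) :
    Integrable (fun ω => (∑ x, f x * (g x ω - 1)) ^ 2) P ∧
      ∫ ω, (∑ x, f x * (g x ω - 1)) ^ 2 ∂P = ∑ x, ∑ y, f x * f y *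
        (∫ ω, g x ω * g y ω ∂P - ∫ ω, g x ω ∂P - ∫ ω, g y ω ∂P + 1) := by
  have hexp : (fun ω => (∑ x, f x * (g x ω - 1)) ^ 2) = fun ω => ∑ x, ∑ y,
      f x * f y * (g x ω * g y ω - g x ω - g y ω + 1) := by
    funext ω
    rw [sq, Finset.sum_mul_sum]
    exact Finset.sum_congr rfl fun x _ => Finset.sum_congr rfl fun y _ => by ring
  have hint : ∀ x y, Integrable (fun ω => g x ω * g y ω - g x ω - g y ω + 1) P := fun x y =>
    (((hgg x y).sub (hg x)).sub (hg y)).add (integrable_const 1)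
  rw [hexp]
  refine ⟨integrable_finsetSum _ fun x _ => integrable_finsetSum _ fun y _ =>
    (hint x y).const_mul _, ?_⟩
  rw [integral_finsetSum _ fun x _ => integrable_finsetSum _ fun y _ => (hint x y).const_mul _]
  refine Finset.sum_congr rfl fun x _ => ?_
  rw [integral_finsetSum _ fun y _ => (hint x y).const_mul _]
  refine Finset.sum_congr rfl fun y _ => ?_
  have h1 : Integrable (fun ω => g x ω * g y ω - g x ω) P := (hgg x y).sub (hg x)
  have h2 : Integrable (fun ω => g x ω * g y ω - g x ω - g y ω) P := h1.sub (hg y)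
  rw [integral_const_mul, integral_add h2 (integrable_const 1), integral_sub h1 (hg y),
    integral_sub (hgg x y) (hg x)]
  simp

theorem integral_sq_weighted_sum_le (hw : ∀ x, 0 ≤ w x) (hg : ∀ x, Integrable (g x) P)
    (hgg : ∀ x y, Integrable (fun ω => g x ω * g y ω) P) {f : X → ℝ} {M : ℝ}
    (hf : ∀ x, |f x| ≤ M) :
    ∫ ω, (∑ x, f x * w x * (g x ω - 1)) ^ 2 ∂P ≤ M ^ 2 * momentDefect P w g := by
  rw [(integrable_sq_weighted_sum hg hgg fun x => f x * w x).2, momentDefect, Finset.mul_sum]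
  refine Finset.sum_le_sum fun x _ => ?_
  rw [Finset.mul_sum]
  refine Finset.sum_le_sum fun y _ => ?_
  set K := ∫ ω, g x ω * g y ω ∂P
  set a := ∫ ω, g x ω ∂P
  set b := ∫ ω, g y ω ∂P
  have hM : 0 ≤ M := (abs_nonneg _).trans (hf x)
  have h1 : |K - a - b + 1| ≤ |K - 1| + |a - 1| + |b - 1| := by
    have : K - a - b + 1 = (K - 1) - (a - 1) - (b - 1) := by ring
    rw [this]
    exact (abs_sub _ _).trans (add_le_add_left (abs_sub _ _) _)
  calc f x * w x * (f y * w y) * (K - a - b + 1)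
      ≤ |f x * w x * (f y * w y) * (K - a - b + 1)| := le_abs_self _
    _ = |f x| * |f y| * (w x * w y) * |K - a - b + 1| := by
        simp only [abs_mul, abs_of_nonneg (hw _)]; ring
    _ ≤ M * M * (w x * w y) * (|K - 1| + |a - 1| + |b - 1|) := by
        have := hw x; have := hw y; have := hf x; have := hf y
        gcongr
    _ = _ := by ring

/-- Averages with respect to the random weights `w x * g x ω` are close, in probability, to
averages with respect to `w` when the moment defect is small. Nothing has to be known about the
normalising constant `∑ w x * g x ω`: it is the case `f = 1` of the numerator. -/
theorem measure_le_abs_weighted_average_sub_le (hw : ∀ x, 0 ≤ w x) (hsum : ∑ x, w x = 1)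
    (hg : ∀ x, Integrable (g x) P) (hgg : ∀ x y, Integrable (fun ω => g x ω * g y ω) P)
    (hpos : ∀ ω, 0 < ∑ x, w x * g x ω) (hg0 : ∀ x ω, 0 ≤ g x ω)
    {f : X → ℝ} {M : ℝ} (hf : ∀ x, |f x| ≤ M) {ε : ℝ} (hε : 0 < ε) :
    P.real {ω | ε ≤ |(∑ x, f x * (w x * g x ω)) / (∑ x, w x * g x ω) - ∑ x, f x * w x|} ≤
      4 * M ^ 2 * momentDefect P w g / ε ^ 2 := by
  set D : Ω → ℝ := fun ω => 2 * (∑ x, f x * w x * (g x ω - 1)) ^ 2 +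
    2 * (∑ x, M * w x * (g x ω - 1)) ^ 2 with hD
  have hi1 := (integrable_sq_weighted_sum hg hgg fun x => f x * w x).1
  have hi2 := (integrable_sq_weighted_sum hg hgg fun x => M * w x).1
  have hDi : Integrable D P := (hi1.const_mul 2).add (hi2.const_mul 2)
  have hM : 0 ≤ M := by
    have : Nonempty X := by
      by_contra h
      rw [not_nonempty_iff] at h
      simp at hsum
    exact (abs_nonneg _).trans (hf (Classical.arbitrary X))
  have hDle : ∫ ω, D ω ∂P ≤ 4 * M ^ 2 * momentDefect P w g := by
    rw [hD, integral_add (hi1.const_mul 2) (hi2.const_mul 2), integral_const_mul,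
      integral_const_mul]
    have h1 := integral_sq_weighted_sum_le hw hg hgg hf
    have h2 := integral_sq_weighted_sum_le hw hg hgg (f := fun _ => M) (M := M)
      (fun _ => (abs_of_nonneg hM).le)
    linarith
  have hmarkov := mul_meas_ge_le_integral_of_nonneg (μ := P) (f := D)
    (.of_forall fun ω => by positivity) hDi (ε ^ 2)
  rw [le_div_iff₀ (by positivity), mul_comm]
  refine (mul_le_mul_of_nonneg_left (measureReal_mono fun ω hω => ?_) (by positivity)).trans
    (hmarkov.trans hDle)
  rw [Set.mem_ofPred_eq] at hω ⊢
  set A := ∑ x, f x * (w x * g x ω)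
  set B := ∑ x, w x * g x ω
  have hB : 0 < B := hpos ω
  have hA1 : ∑ x, f x * w x * (g x ω - 1) = A - ∑ x, f x * w x := by
    rw [← Finset.sum_sub_distrib]
    exact Finset.sum_congr rfl fun x _ => by ring
  have hB1 : ∑ x, M * w x * (g x ω - 1) = M * (B - 1) := by
    have : B - 1 = ∑ x, w x * (g x ω - 1) := by
      simp only [mul_sub, mul_one, Finset.sum_sub_distrib, hsum, B]
    rw [this, Finset.mul_sum]
    exact Finset.sum_congr rfl fun x _ => by ring
  have hAB : |A / B| ≤ M := by
    rw [abs_div, abs_of_pos hB, div_le_iff₀ hB, Finset.mul_sum]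
    refine (Finset.abs_sum_le_sum_abs _ _).trans (Finset.sum_le_sum fun x _ => ?_)
    rw [abs_mul, abs_of_nonneg (mul_nonneg (hw x) (hg0 x ω))]
    exact mul_le_mul_of_nonneg_right (hf x) (mul_nonneg (hw x) (hg0 x ω))
  simp only [hD, hA1, hB1]
  have hsplit : A / B - ∑ x, f x * w x = (A - ∑ x, f x * w x) + A / B * (1 - B) := by
    field_simp; ring
  have h1 : |A / B - ∑ x, f x * w x| ≤ |A - ∑ x, f x * w x| + M * |B - 1| := by
    rw [hsplit]
    refine (abs_add_le _ _).trans (add_le_add_right ?_ _)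
    rw [abs_mul, abs_sub_comm 1 B]
    exact mul_le_mul_of_nonneg_right hAB (abs_nonneg _)
  have h2 : ε ^ 2 ≤ (|A - ∑ x, f x * w x| + M * |B - 1|) ^ 2 :=
    pow_le_pow_left₀ hε.le (hω.trans h1) 2
  have h3 := sq_abs (A - ∑ x, f x * w x)
  have h4 := sq_abs (B - 1)
  nlinarith [sq_nonneg (|A - ∑ x, f x * w x| - M * |B - 1|)]

end Reweighting

/-! ### Bonds and magnetization -/

/-- The total magnetization `∑ x_i`. -/
def magnetization {N : ℕ} (x : Config N) : ℝ := ∑ i, spin (x i)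

/-- The interaction `x_i x_j` along the edge `e = (i, j)`. -/
def bond {N : ℕ} (x : Config N) (e : Fin N × Fin N) : ℝ := spin (x e.1) * spin (x e.2)

theorem spin_mul (s u : ℤˣ) : spin (s * u) = spin s * spin u := by simp [spin]

theorem spin_sq (s : ℤˣ) : spin s ^ 2 = 1 := by
  rcases Int.units_eq_one_or s with h | h <;> simp [spin, h]

theorem bond_sq {N : ℕ} (x : Config N) (e : Fin N × Fin N) : bond x e ^ 2 = 1 := by
  rw [bond, mul_pow, spin_sq, spin_sq, one_mul]

theorem abs_bond {N : ℕ} (x : Config N) (e : Fin N × Fin N) : |bond x e| = 1 := by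
  rw [← sq_eq_sq₀ (abs_nonneg _) zero_le_one, sq_abs, bond_sq, one_pow]

theorem bond_mul {N : ℕ} (x y : Config N) (e : Fin N × Fin N) :
    bond (x * y) e = bond x e * bond y e := by
  simp only [bond, Pi.mul_apply, spin_mul]; ring

theorem sum_bond {N : ℕ} (x : Config N) : ∑ e, bond x e = magnetization x ^ 2 := by
  rw [sq, magnetization, Finset.sum_mul_sum, Fintype.sum_prod_type]
  rfl

theorem exponentCW_eq (β : ℝ) {N : ℕ} (x : Config N) :
    exponentCW β N x = β / (2 * N) * magnetization x ^ 2 := by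
  rw [exponentCW, ← sum_bond, Fintype.sum_prod_type]
  rfl

/-! ### Second-order expansion of the moments of the reweighting -/

theorem abs_exp_sub_one_le_of_abs_le {u v : ℝ} (h : |u| ≤ v) :
    |Real.exp u - 1| ≤ Real.exp v - 1 := by
  have h1 := abs_le.1 h
  rw [abs_le]
  constructor
  · have := Real.add_one_le_exp u
    have := Real.add_one_le_exp v
    linarith
  · have := Real.exp_le_exp.2 h1.2
    linarith

theorem abs_log_one_add_sub_le {a : ℝ} (ha : |a| ≤ 1 / 2) :
    |Real.log (1 + a) - (a - a ^ 2 / 2)| ≤ 2 * |a| ^ 3 := by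
  have h := Real.abs_log_sub_add_sum_range_le (x := -a) (by rw [abs_neg]; linarith) 2
  rw [abs_neg, sub_neg_eq_add] at h
  have h2 : ∑ i ∈ Finset.range 2, (-a) ^ (i + 1) / ((i : ℝ) + 1) = -(a - a ^ 2 / 2) := by
    simp [Finset.sum_range_succ]; ring
  rw [h2, neg_add_eq_sub] at h
  refine h.trans ?_
  rw [div_le_iff₀ (by linarith)]
  have h3 : 0 ≤ |a| ^ 3 * (1 - 2 * |a|) :=
    mul_nonneg (pow_nonneg (abs_nonneg a) 3) (by linarith)
  norm_num only
  linarith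

theorem exists_prod_one_add_eq_exp {ι : Type*} [Fintype ι] {a : ι → ℝ} {κ : ℝ}
    (hκ : κ ≤ 1 / 2) (ha : ∀ e, |a e| ≤ κ) :
    ∃ R : ℝ, |R| ≤ Fintype.card ι * (2 * κ ^ 3) ∧
      ∏ e, (1 + a e) = Real.exp (∑ e, (a e - a e ^ 2 / 2) + R) := by
  refine ⟨∑ e, (Real.log (1 + a e) - (a e - a e ^ 2 / 2)), ?_, ?_⟩
  · refine (Finset.abs_sum_le_sum_abs _ _).trans ?_
    rw [← nsmul_eq_mul, ← Finset.card_univ, ← Finset.sum_const]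
    refine Finset.sum_le_sum fun e _ =>
      (abs_log_one_add_sub_le ((ha e).trans hκ)).trans ?_
    have := ha e
    gcongr
  · rw [← Finset.sum_add_distrib]
    simp only [add_sub_cancel, Real.exp_sum]
    refine Finset.prod_congr rfl fun e _ => (Real.exp_log ?_).symm
    have := (abs_le.1 (ha e)).1
    linarith

/-- The quantity that controls the logarithms of the first two moments of the reweighting. The
overlap `∑ x_i y_i` is the magnetization of the product configuration `x * y`. -/
noncomputable def overlapSum {N : ℕ} (x y : Config N) : ℝ :=
  1 + (magnetization x ^ 2 + magnetization y ^ 2 + magnetization (x * y) ^ 2) / N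

/-- The rate at which the moments of the reweighting approach `1`, where
`p tanh (β / (2Np)) = c / N` and `p tanh² (β / (2Np)) = r / N`. -/
noncomputable def momentRate (β : ℝ) (N : ℕ) (c r : ℝ) : ℝ :=
  |c - β / 2| + |r| + c ^ 2 / N + |c| * |r| / N + r ^ 2 + 2 * (2 * |c| + |r|) ^ 3 / N

theorem momentRate_nonneg (β : ℝ) (N : ℕ) (c r : ℝ) : 0 ≤ momentRate β N c r := by
  unfold momentRate; positivity

theorem one_le_overlapSum {N : ℕ} (x y : Config N) : 1 ≤ overlapSum x y := by
  unfold overlapSum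
  have : 0 ≤ (magnetization x ^ 2 + magnetization y ^ 2 + magnetization (x * y) ^ 2) / N := by
    positivity
  linarith

/-- As bonds are signs, the second-order term of the logarithm is, up to small errors, a constant
(compensated by the two factors `exp (c² / 2)`) plus a multiple of the squared overlap of order
`1 / N`. -/
theorem abs_second_moment_sub_one_le (β : ℝ) {N : ℕ} (hN : 0 < N) {c r : ℝ}
    (hcr : (2 * |c| + |r|) / N ≤ 1 / 2) (x y : Config N) :
    |Real.exp (c ^ 2 / 2 - exponentCW β N x) * Real.exp (c ^ 2 / 2 - exponentCW β N y) *
        ∏ e, (1 + (c / N * (bond x e + bond y e) + r / N * (bond x e * bond y e))) - 1| ≤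
      Real.exp (momentRate β N c r * overlapSum x y) - 1 := by
  have hN' : (0 : ℝ) < N := by exact_mod_cast hN
  obtain ⟨R, hR, hprod⟩ := exists_prod_one_add_eq_exp
    (a := fun e : Fin N × Fin N => c / N * (bond x e + bond y e) + r / N * (bond x e * bond y e))
    hcr (fun e => by
      refine (abs_add_le _ _).trans ?_
      rw [abs_mul, abs_mul, abs_mul, abs_bond, abs_bond, abs_div, abs_div, Nat.abs_cast]
      have := (abs_add_le (bond x e) (bond y e))
      rw [abs_bond, abs_bond] at this
      have h2 : |c| / N * |bond x e + bond y e| ≤ |c| / N * (1 + 1) := by gcongr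
      calc _ ≤ |c| / N * (1 + 1) + |r| / N * (1 * 1) := by linarith
        _ = _ := by ring)
  rw [hprod, ← Real.exp_add, ← Real.exp_add]
  refine abs_exp_sub_one_le_of_abs_le ?_
  -- In `a - a² / 2`, squares of bonds are `1`, so only the bonds of `x`, `y` and `x * y` remain.
  have hterm : ∀ e : Fin N × Fin N,
      (c / N * (bond x e + bond y e) + r / N * (bond x e * bond y e)) -
        (c / N * (bond x e + bond y e) + r / N * (bond x e * bond y e)) ^ 2 / 2 =
      (c / N - c / N * (r / N)) * bond x e + (c / N - c / N * (r / N)) * bond y e +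
        (r / N - (c / N) ^ 2) * bond (x * y) e - ((c / N) ^ 2 + (r / N) ^ 2 / 2) := by
    intro e
    rw [bond_mul]
    have h1 := bond_sq x e
    have h2 := bond_sq y e
    generalize bond x e = s at *
    generalize bond y e = u at *
    generalize c / (N : ℝ) = q
    generalize r / (N : ℝ) = ρ
    linear_combination (-q ^ 2 / 2 - q * ρ * u - ρ ^ 2 / 2 * u ^ 2) * h1 +
      (-q ^ 2 / 2 - q * ρ * s - ρ ^ 2 / 2) * h2
  simp only [hterm, Finset.sum_sub_distrib, Finset.sum_add_distrib, ← Finset.mul_sum, sum_bond,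
    Finset.sum_const, Finset.card_univ, Fintype.card_prod, Fintype.card_fin, nsmul_eq_mul,
    exponentCW_eq]
  simp only [Fintype.card_prod, Fintype.card_fin] at hR
  push_cast at hR ⊢
  have hR2 : (N : ℝ) * N * (2 * ((2 * |c| + |r|) / N) ^ 3) = 2 * (2 * |c| + |r|) ^ 3 / N := by
    field_simp
  rw [hR2] at hR
  set Sx := magnetization x ^ 2 with hSx
  set Sy := magnetization y ^ 2
  set O := magnetization (x * y) ^ 2
  have hSx0 : 0 ≤ Sx := sq_nonneg _
  have hSy0 : 0 ≤ Sy := sq_nonneg _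
  have hO0 : 0 ≤ O := sq_nonneg _
  have heq : c ^ 2 / 2 - β / (2 * N) * Sx + (c ^ 2 / 2 - β / (2 * N) * Sy) +
      ((c / N - c / N * (r / N)) * Sx + (c / N - c / N * (r / N)) * Sy +
        (r / N - (c / N) ^ 2) * O -
          ((N : ℝ) * N * (c / N) ^ 2 + (N : ℝ) * N * ((r / N) ^ 2 / 2)) + R) =
      (c - β / 2) * ((Sx + Sy) / N) + r * (O / N) - c ^ 2 / N * (O / N) -
        c * r / N * ((Sx + Sy) / N) - r ^ 2 / 2 + R := by
    field_simp; ring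
  rw [heq]
  have hov : overlapSum x y = 1 + (Sx + Sy) / N + O / N := by
    rw [overlapSum, ← hSx]; ring
  rw [hov]
  set A := (Sx + Sy) / N
  set B := O / N
  have hA : 0 ≤ A := by positivity
  have hB : 0 ≤ B := by positivity
  have e1 : |(c - β / 2) * A| = |c - β / 2| * A := by rw [abs_mul, abs_of_nonneg hA]
  have e2 : |r * B| = |r| * B := by rw [abs_mul, abs_of_nonneg hB]
  have e3 : |c ^ 2 / N * B| = c ^ 2 / N * B := abs_of_nonneg (by positivity)
  have e4 : |c * r / N * A| = |c| * |r| / N * A := by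
    rw [abs_mul, abs_div, abs_mul, abs_of_nonneg hA, Nat.abs_cast]
  have e5 : |r ^ 2 / 2| = r ^ 2 / 2 := abs_of_nonneg (by positivity)
  have htri := (abs_add_le ((c - β / 2) * A + r * B - c ^ 2 / N * B - c * r / N * A - r ^ 2 / 2)
    R).trans (add_le_add_left ((abs_sub _ _).trans (add_le_add_left
      ((abs_sub _ _).trans (add_le_add_left ((abs_sub _ _).trans (add_le_add_left
      (abs_add_le _ _) _)) _)) _)) _)
  rw [e1, e2, e3, e4, e5] at htri
  refine htri.trans ?_
  unfold momentRate
  have p1 : 0 ≤ |c - β / 2| := abs_nonneg _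
  have p2 : 0 ≤ |r| := abs_nonneg _
  have p3 : 0 ≤ c ^ 2 / N := by positivity
  have p4 : 0 ≤ |c| * |r| / N := by positivity
  have p5 : 0 ≤ r ^ 2 := by positivity
  have p6 : 0 ≤ 2 * (2 * |c| + |r|) ^ 3 / N := by positivity
  generalize |c - β / 2| = d1 at *
  generalize |c| * |r| / N = d4 at *
  generalize |r| = d2 at *
  generalize c ^ 2 / N = d3 at *
  generalize 2 * (2 * |c| + d2) ^ 3 / N = d6 at *
  have : d1 * A + d2 * B + d3 * B + d4 * A + r ^ 2 / 2 + d6 ≤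
      (d1 + d2 + d3 + d4 + r ^ 2 + d6) * (1 + A + B) := by
    have : 0 ≤ d1 * (1 + B) + d2 * (1 + A) + d3 * (1 + A) + d4 * (1 + B) +
      r ^ 2 * (1 / 2 + A + B) + d6 * (A + B) := by positivity
    linarith
  linarith

/-- The configuration `y` is arbitrary: the bound is weakened so as to share the form of the one for
second moments. -/
theorem abs_first_moment_sub_one_le (β : ℝ) {N : ℕ} (hN : 0 < N) {c r : ℝ}
    (hcr : (2 * |c| + |r|) / N ≤ 1 / 2) (x y : Config N) :
    |Real.exp (c ^ 2 / 2 - exponentCW β N x) * ∏ e, (1 + c / N * bond x e) - 1| ≤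
      Real.exp (momentRate β N c r * overlapSum x y) - 1 := by
  have hN' : (0 : ℝ) < N := by exact_mod_cast hN
  obtain ⟨R, hR, hprod⟩ := exists_prod_one_add_eq_exp
    (a := fun e : Fin N × Fin N => c / N * bond x e) hcr (fun e => by
      rw [abs_mul, abs_bond, abs_div, Nat.abs_cast, mul_one]
      gcongr
      have := abs_nonneg c
      have := abs_nonneg r
      linarith)
  rw [hprod, ← Real.exp_add]
  refine abs_exp_sub_one_le_of_abs_le ?_
  have hterm : ∀ e : Fin N × Fin N, c / N * bond x e - (c / N * bond x e) ^ 2 / 2 =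
      c / N * bond x e - (c / N) ^ 2 / 2 := by
    intro e
    rw [mul_pow, bond_sq, mul_one]
  simp only [hterm, Finset.sum_sub_distrib, ← Finset.mul_sum, sum_bond,
    Finset.sum_const, Finset.card_univ, Fintype.card_prod, Fintype.card_fin, nsmul_eq_mul,
    exponentCW_eq]
  simp only [Fintype.card_prod, Fintype.card_fin] at hR
  push_cast at hR ⊢
  have hR2 : (N : ℝ) * N * (2 * ((2 * |c| + |r|) / N) ^ 3) = 2 * (2 * |c| + |r|) ^ 3 / N := by
    field_simp
  rw [hR2] at hR
  set Sx := magnetization x ^ 2 with hSx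
  have heq : c ^ 2 / 2 - β / (2 * N) * Sx +
      (c / N * Sx - (N : ℝ) * N * ((c / N) ^ 2 / 2) + R) =
      (c - β / 2) * (Sx / N) + R := by
    field_simp; ring
  rw [heq]
  have hA : 0 ≤ Sx / N := div_nonneg (sq_nonneg _) hN'.le
  have hov : Sx / N ≤ overlapSum x y := by
    have : overlapSum x y = 1 + Sx / N + magnetization y ^ 2 / N +
        magnetization (x * y) ^ 2 / N := by rw [overlapSum, ← hSx]; ring
    rw [this]
    have : 0 ≤ magnetization y ^ 2 / N := by positivity
    have : 0 ≤ magnetization (x * y) ^ 2 / N := by positivity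
    linarith
  have hov1 := one_le_overlapSum x y
  refine (abs_add_le _ _).trans ?_
  rw [abs_mul, abs_of_nonneg hA]
  calc |c - β / 2| * (Sx / N) + |R|
      ≤ |c - β / 2| * overlapSum x y + 2 * (2 * |c| + |r|) ^ 3 / N * overlapSum x y := by
        have h6 : 0 ≤ 2 * (2 * |c| + |r|) ^ 3 / N := by positivity
        have := le_mul_of_one_le_right h6 hov1
        have := mul_le_mul_of_nonneg_left hov (abs_nonneg (c - β / 2))
        linarith
    _ = (|c - β / 2| + 2 * (2 * |c| + |r|) ^ 3 / N) * overlapSum x y := by ring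
    _ ≤ momentRate β N c r * overlapSum x y := by
        refine mul_le_mul_of_nonneg_right ?_ (zero_le_one.trans hov1)
        unfold momentRate
        have : 0 ≤ |r| + c ^ 2 / N + |c| * |r| / N + r ^ 2 := by positivity
        linarith

/-! ### Exponential moments of the squared magnetization -/

theorem sum_exp_mul_magnetization (N : ℕ) (u : ℝ) :
    ∑ x : Config N, Real.exp (u * magnetization x) = (2 * Real.cosh u) ^ N := by
  have h : ∀ x : Config N, Real.exp (u * magnetization x) = ∏ i, Real.exp (u * spin (x i)) := by
    intro x
    rw [magnetization, Finset.mul_sum, Real.exp_sum]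
  simp only [h]
  have h2 : ∑ s : ℤˣ, Real.exp (u * spin s) = 2 * Real.cosh u := by
    rw [Real.cosh_eq]
    simp [UnitsInt.univ, spin]
    ring
  have h3 := Finset.sum_prod_piFinset (Finset.univ : Finset ℤˣ)
    fun (_ : Fin N) (s : ℤˣ) => Real.exp (u * spin s)
  rw [Fintype.piFinset_univ, h2] at h3
  simpa using h3

/-- The Gaussian integral behind the Hubbard-Stratonovich transform: it turns `exp (u² / 2)` into a
superposition of exponentials that are linear in `u`. -/
theorem integral_exp_mul_sub_sq (u : ℝ) :
    Integrable (fun g : ℝ => Real.exp (u * g - g ^ 2 / 2)) ∧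
      ∫ g : ℝ, Real.exp (u * g - g ^ 2 / 2) =
        √(2 * Real.pi) * Real.exp (u ^ 2 / 2) := by
  have h : (fun g : ℝ => Real.exp (u * g - g ^ 2 / 2)) =
      fun g => Real.exp (u ^ 2 / 2) * Real.exp (-(1 / 2) * (g - u) ^ 2) := by
    funext g
    rw [← Real.exp_add]
    ring_nf
  rw [h]
  refine ⟨((integrable_exp_neg_mul_sq (by norm_num : (0 : ℝ) < 1 / 2)).comp_sub_right
    u).const_mul _, ?_⟩
  rw [integral_const_mul,
    integral_sub_right_eq_self (fun g : ℝ => Real.exp (-(1 / 2) * g ^ 2)) u, integral_gaussian,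
    mul_comm]
  congr 2
  field_simp

/-- The linearised exponent factorises over the sites, and `cosh u ≤ exp (u² / 2)`. -/
theorem sum_exp_sq_magnetization_le {N : ℕ} (hN : 0 < N) {θ : ℝ} (h0 : 0 ≤ θ) (h1 : θ < 1) :
    ∑ x : Config N, Real.exp (θ / 2 * (magnetization x ^ 2 / N)) ≤ 2 ^ N * (√(1 - θ))⁻¹ := by
  have hN' : (0 : ℝ) < N := by exact_mod_cast hN
  set a := √(θ / N) with ha
  have ha2 : a ^ 2 = θ / N := Real.sq_sqrt (by positivity)
  have hpi : 0 < √(2 * Real.pi) := Real.sqrt_pos.2 (by positivity)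
  have hsum : √(2 * Real.pi) * ∑ x : Config N, Real.exp (θ / 2 * (magnetization x ^ 2 / N)) =
      ∫ g : ℝ, ∑ x : Config N, Real.exp (a * magnetization x * g - g ^ 2 / 2) := by
    rw [integral_finsetSum _ fun x _ => (integral_exp_mul_sub_sq _).1, Finset.mul_sum]
    refine Finset.sum_congr rfl fun x _ => ?_
    rw [(integral_exp_mul_sub_sq _).2, mul_pow, ha2]
    congr 2
    ring
  have hle : ∀ g : ℝ, ∑ x : Config N, Real.exp (a * magnetization x * g - g ^ 2 / 2) ≤
      2 ^ N * Real.exp (-((1 - θ) / 2) * g ^ 2) := by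
    intro g
    have : ∀ x : Config N, Real.exp (a * magnetization x * g - g ^ 2 / 2) =
        Real.exp (-(g ^ 2 / 2)) * Real.exp (a * g * magnetization x) := by
      intro x; rw [← Real.exp_add]; ring_nf
    simp only [this]
    rw [← Finset.mul_sum, sum_exp_mul_magnetization, mul_pow]
    calc Real.exp (-(g ^ 2 / 2)) * (2 ^ N * Real.cosh (a * g) ^ N)
        ≤ Real.exp (-(g ^ 2 / 2)) * (2 ^ N * Real.exp ((a * g) ^ 2 / 2) ^ N) := by
          have := Real.cosh_le_exp_half_sq (a * g)
          have := (Real.cosh_pos (a * g)).le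
          gcongr
      _ = 2 ^ N * Real.exp (-((1 - θ) / 2) * g ^ 2) := by
          rw [← Real.exp_nat_mul, mul_left_comm, ← Real.exp_add, mul_pow, ha2]
          congr 2
          field_simp
          ring
  have hint := integral_mono (integrable_finsetSum _ fun x _ => (integral_exp_mul_sub_sq _).1)
    ((integrable_exp_neg_mul_sq (by linarith : 0 < (1 - θ) / 2)).const_mul (2 ^ N)) hle
  rw [← hsum, integral_const_mul, integral_gaussian] at hint
  have hsq : √(Real.pi / ((1 - θ) / 2)) = √(2 * Real.pi) * (√(1 - θ))⁻¹ := by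
    rw [← Real.sqrt_inv, ← Real.sqrt_mul (by positivity)]
    congr 1
    field_simp
  rw [hsq] at hint
  refine le_of_mul_le_mul_left ?_ hpi
  linarith

/-! ### Curie-Weiss weights -/

theorem card_config (N : ℕ) : (Fintype.card (Config N) : ℝ) = 2 ^ N := by
  simp [Config]

/-- The probability of a configuration under the Curie-Weiss measure, as a real number. -/
noncomputable def cwWeight (β : ℝ) (N : ℕ) (x : Config N) : ℝ :=
  Real.exp (exponentCW β N x) / ∑ y, Real.exp (exponentCW β N y)

theorem sum_exp_pos {N : ℕ} (H : Config N → ℝ) : 0 < ∑ y, Real.exp (H y) :=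
  Finset.sum_pos (fun _ _ => Real.exp_pos _) Finset.univ_nonempty

theorem cwWeight_pos (β : ℝ) (N : ℕ) (x : Config N) : 0 < cwWeight β N x :=
  div_pos (Real.exp_pos _) (sum_exp_pos _)

theorem sum_cwWeight (β : ℝ) (N : ℕ) : ∑ x, cwWeight β N x = 1 := by
  simp only [cwWeight]
  rw [← Finset.sum_div, div_self (sum_exp_pos _).ne']

/-- A lower bound for the Curie-Weiss partition function that is also valid for negative `β`; it
rests on a bound for the second moment of the magnetization of uniform spins. -/
theorem le_sum_exp_exponentCW (β : ℝ) {N : ℕ} (hN : 0 < N) :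
    2 ^ N * Real.exp (-(3 * |β|)) ≤ ∑ x, Real.exp (exponentCW β N x) := by
  have hN' : (0 : ℝ) < N := by exact_mod_cast hN
  have hsecond : ∑ x : Config N, magnetization x ^ 2 / N ≤ 2 ^ N * 6 := by
    have h := sum_exp_sq_magnetization_le hN (θ := 1 / 2) (by norm_num) (by norm_num)
    have h2 : ∑ x : Config N, magnetization x ^ 2 / N ≤
        ∑ x : Config N, 4 * Real.exp (1 / 2 / 2 * (magnetization x ^ 2 / N)) :=
      Finset.sum_le_sum fun x _ => by
        have := Real.add_one_le_exp (1 / 2 / 2 * (magnetization x ^ 2 / N))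
        linarith
    rw [← Finset.mul_sum] at h2
    have h3 : (√(1 - 1 / 2 : ℝ))⁻¹ ≤ 3 / 2 := by
      rw [← Real.sqrt_inv, Real.sqrt_le_left (by norm_num)]
      norm_num
    have h4 := mul_le_mul_of_nonneg_left h3 (by positivity : (0 : ℝ) ≤ 2 ^ N)
    linarith
  -- The tangent of `exp` at `-3|β|` lies below `exp`.
  have hpt : ∀ x : Config N, Real.exp (-(3 * |β|)) *
      (1 + 3 * |β| - |β| / 2 * (magnetization x ^ 2 / N)) ≤ Real.exp (exponentCW β N x) := by
    intro x
    have hle : -(|β| / 2 * (magnetization x ^ 2 / N)) ≤ exponentCW β N x := by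
      rw [exponentCW_eq]
      have h : 0 ≤ magnetization x ^ 2 / N := by positivity
      have := mul_le_mul_of_nonneg_right (neg_abs_le β) h
      have he : β / (2 * N) * magnetization x ^ 2 = β * (magnetization x ^ 2 / N) / 2 := by
        field_simp
      rw [he]
      linarith
    have h1 := Real.add_one_le_exp (3 * |β| - |β| / 2 * (magnetization x ^ 2 / N))
    calc _ ≤ Real.exp (-(3 * |β|)) *
          Real.exp (3 * |β| - |β| / 2 * (magnetization x ^ 2 / N)) := by
          refine mul_le_mul_of_nonneg_left ?_ (Real.exp_pos _).le
          linarith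
      _ ≤ _ := by
          rw [← Real.exp_add]
          exact Real.exp_le_exp.2 (by linarith)
  refine le_trans ?_ (Finset.sum_le_sum fun x _ => hpt x)
  rw [← Finset.mul_sum, mul_comm, Finset.sum_sub_distrib, ← Finset.mul_sum, Finset.sum_const,
    Finset.card_univ, nsmul_eq_mul, card_config]
  refine mul_le_mul_of_nonneg_left ?_ (Real.exp_pos _).le
  have := mul_le_mul_of_nonneg_left hsecond (by positivity : 0 ≤ |β| / 2)
  linarith

/-- Two independent Curie-Weiss configurations with `β < 1` have a bounded exponential moment of
`overlapSum`. Under uniform spins the overlap has the law of a magnetization, because `y ↦ x * y` is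
a bijection. -/
theorem exists_sum_exp_overlapSum_le {β : ℝ} (hβ : β < 1) :
    ∃ l : ℝ, 0 < l ∧ ∃ C : ℝ, ∀ N : ℕ, 0 < N →
      ∑ x : Config N, ∑ y : Config N, cwWeight β N x * cwWeight β N y *
        Real.exp (l * overlapSum x y) ≤ C := by
  set b := max β 0 with hb
  have hb0 : 0 ≤ b := le_max_right _ _
  have hb1 : b < 1 := max_lt hβ one_pos
  have hβb : β ≤ b := le_max_left _ _
  set θ := (1 + b) / 2 with hθ
  -- With `h = (1 - b) / 4` and `l = (1 - b) / 20` both `(1 + h) (b / 2 + l) ≤ θ / 2` and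
  -- `(1 + 1 / h) l ≤ θ / 2`.
  set h := (1 - b) / 4 with hh
  set l := (1 - b) / 20 with hl
  have hh0 : 0 < h := by rw [hh]; linarith
  have hl0 : 0 < l := by rw [hl]; linarith
  have hlh : 5 * l = h := by rw [hh, hl]; ring
  have k1 : (1 + h) * (b / 2 + l) ≤ θ / 2 := by rw [hh, hl, hθ]; nlinarith
  have hθ0 : 0 ≤ θ := by rw [hθ]; linarith
  have hθ1 : θ < 1 := by rw [hθ]; linarith
  set D := (√(1 - θ))⁻¹ with hD
  have hD0 : 0 < D := inv_pos.2 (Real.sqrt_pos.2 (by linarith))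
  refine ⟨l, hl0, Real.exp l * (D ^ 2 + D) / Real.exp (-(3 * |β|)) ^ 2,
    fun N hN => ?_⟩
  have hN' : (0 : ℝ) < N := by exact_mod_cast hN
  have hpt : ∀ x y : Config N, Real.exp (exponentCW β N x) * Real.exp (exponentCW β N y) *
      Real.exp (l * overlapSum x y) ≤ Real.exp l *
      (Real.exp (θ / 2 * (magnetization x ^ 2 / N)) * Real.exp (θ / 2 * (magnetization y ^ 2 / N)) +
        Real.exp (θ / 2 * (magnetization (x * y) ^ 2 / N))) := by
    intro x y
    set A := magnetization x ^ 2 / N + magnetization y ^ 2 / N with hA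
    set B := magnetization (x * y) ^ 2 / N with hB
    have hA0 : 0 ≤ A := by positivity
    have hB0 : 0 ≤ B := by positivity
    have e1 : exponentCW β N x + exponentCW β N y + l * overlapSum x y =
        l + (β / 2 * A + l * A + l * B) := by
      rw [exponentCW_eq, exponentCW_eq, overlapSum, hA, hB]
      field_simp
      ring
    have e2 : β / 2 * A + l * A ≤ (b / 2 + l) * A := by
      have := mul_le_mul_of_nonneg_right hβb hA0
      linarith
    rw [← Real.exp_add, ← Real.exp_add, e1, Real.exp_add l,
      ← Real.exp_add (θ / 2 * _), ← mul_add (θ / 2), ← hA]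
    refine mul_le_mul_of_nonneg_left ?_ (Real.exp_pos _).le
    have hX : 0 ≤ (b / 2 + l) * A := by positivity
    -- Either the overlap term is at most `h` times the magnetization term, or conversely.
    rcases le_total (l * B) (h * ((b / 2 + l) * A)) with hc | hc
    · refine (Real.exp_le_exp.2 ?_).trans (le_add_of_nonneg_right (Real.exp_pos _).le)
      have := mul_le_mul_of_nonneg_right k1 hA0
      linarith
    · refine (Real.exp_le_exp.2 ?_).trans (le_add_of_nonneg_left (Real.exp_pos _).le)
      rw [← hlh] at hc
      have hc' : (b / 2 + l) * A ≤ B / 5 := by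
        have : l * (5 * ((b / 2 + l) * A)) ≤ l * B := by linarith
        have := le_of_mul_le_mul_left this hl0
        linarith
      have : l + 1 / 5 ≤ θ / 2 := by rw [hl, hθ]; linarith
      have := mul_le_mul_of_nonneg_right this hB0
      linarith
  have hs := sum_exp_sq_magnetization_le hN hθ0 hθ1
  rw [← hD] at hs
  have hZ := le_sum_exp_exponentCW β hN
  set Z := ∑ x : Config N, Real.exp (exponentCW β N x) with hZdef
  have hZ0 : 0 < Z := sum_exp_pos _
  have hnum : ∑ x : Config N, ∑ y : Config N, Real.exp (exponentCW β N x) *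
      Real.exp (exponentCW β N y) * Real.exp (l * overlapSum x y) ≤
      (2 ^ N) ^ 2 * (Real.exp l * (D ^ 2 + D)) := by
    refine (Finset.sum_le_sum fun x _ => Finset.sum_le_sum fun y _ => hpt x y).trans ?_
    simp only [← Finset.mul_sum, Finset.sum_add_distrib]
    rw [← Finset.sum_mul]
    have hshift : ∀ x : Config N,
        ∑ y : Config N, Real.exp (θ / 2 * (magnetization (x * y) ^ 2 / N)) =
          ∑ y : Config N, Real.exp (θ / 2 * (magnetization y ^ 2 / N)) := fun x =>
      Fintype.sum_equiv (Equiv.mulLeft x) _ _ fun y => rfl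
    simp only [hshift]
    rw [Finset.sum_const, Finset.card_univ, nsmul_eq_mul, card_config]
    set T := ∑ y : Config N, Real.exp (θ / 2 * (magnetization y ^ 2 / N))
    have hT0 : 0 ≤ T := Finset.sum_nonneg fun _ _ => (Real.exp_pos _).le
    calc Real.exp l * (T * T + 2 ^ N * T)
        ≤ Real.exp l * ((2 ^ N * D) * (2 ^ N * D) + 2 ^ N * (2 ^ N * D)) := by gcongr
      _ = _ := by ring
  have hquot : ∑ x : Config N, ∑ y : Config N, cwWeight β N x * cwWeight β N y *
      Real.exp (l * overlapSum x y) =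
      (∑ x : Config N, ∑ y : Config N, Real.exp (exponentCW β N x) *
        Real.exp (exponentCW β N y) * Real.exp (l * overlapSum x y)) / Z ^ 2 := by
    simp only [Finset.sum_div]
    refine Finset.sum_congr rfl fun x _ => Finset.sum_congr rfl fun y _ => ?_
    simp only [cwWeight, ← hZdef]
    field_simp
  rw [hquot, div_le_div_iff₀ (by positivity) (by positivity)]
  calc _ ≤ (2 ^ N) ^ 2 * (Real.exp l * (D ^ 2 + D)) * Real.exp (-(3 * |β|)) ^ 2 := by gcongr
    _ = Real.exp l * (D ^ 2 + D) * (2 ^ N * Real.exp (-(3 * |β|))) ^ 2 := by ring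
    _ ≤ _ := by gcongr

/-! ### The density of the Bovier-Gayrard measure relative to the Curie-Weiss measure -/

/-- Up to a factor that does not depend on the configuration, the density of the Bovier-Gayrard
measure with respect to the Curie-Weiss measure: here `τ = tanh (β / (2Np))`, and the constant
`exp (c² / 2)` makes the mean close to `1` if `c = N p τ`. -/
noncomputable def relDensity (β : ℝ) (N : ℕ) (c τ : ℝ) (x : Config N) (ω : GraphSeq) : ℝ :=
  Real.exp (c ^ 2 / 2 - exponentCW β N x) *
    ∏ e : Fin N × Fin N, (1 + edge ω N e.1 e.2 * (bond x e * τ))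

theorem exp_mul_edge (t : ℝ) {ε s : ℝ} (hε : ε = 0 ∨ ε = 1) (hs : s ^ 2 = 1) :
    Real.exp (t * (ε * s)) =
      (1 + ε * (Real.cosh t - 1)) * (1 + ε * (s * Real.tanh t)) := by
  have hc := (Real.cosh_pos t).ne'
  rw [Real.tanh_eq_sinh_div_cosh]
  rcases hε with rfl | rfl
  · simp
  · rcases sq_eq_sq_iff_eq_or_eq_neg.1 (hs.trans (one_pow 2).symm) with rfl | rfl
    · rw [one_mul, mul_one, ← Real.cosh_add_sinh]; field_simp; ring
    · rw [one_mul, mul_neg_one, ← Real.cosh_sub_sinh]; field_simp; ring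

/-- The factor `∏ cosh (β / (2Np))` over the edges of the graph is the same for all
configurations. It has large fluctuations when `p` is small, but it cancels in the Gibbs measure. -/
theorem exists_exp_exponentBG_eq (β : ℝ) (p : ℕ → unitInterval) (ω : GraphSeq) (N : ℕ) (c : ℝ) :
    ∃ K : ℝ, 0 < K ∧ ∀ x : Config N, Real.exp (exponentBG β p ω N x) =
      K * (Real.exp (exponentCW β N x) *
        relDensity β N c (Real.tanh (β / (2 * N * p N))) x ω) := by
  set t := β / (2 * N * p N) with ht
  refine ⟨Real.exp (-(c ^ 2 / 2)) *
    ∏ e : Fin N × Fin N, (1 + edge ω N e.1 e.2 * (Real.cosh t - 1)), ?_, fun x => ?_⟩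
  · refine mul_pos (Real.exp_pos _) (Finset.prod_pos fun e _ => ?_)
    have := Real.cosh_pos t
    rcases edge_eq_zero_or_one ω N e.1 e.2 with h | h <;> rw [h]
    · norm_num
    · linarith
  · have h1 : exponentBG β p ω N x =
        ∑ e : Fin N × Fin N, t * (edge ω N e.1 e.2 * bond x e) := by
      rw [exponentBG, ← Finset.mul_sum, Fintype.sum_prod_type]
      simp only [bond, mul_assoc, ht]
    have h2 : Real.exp (-(c ^ 2 / 2)) * (Real.exp (exponentCW β N x) *
        Real.exp (c ^ 2 / 2 - exponentCW β N x)) = 1 := by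
      rw [← Real.exp_add, ← Real.exp_add]
      simp
    rw [h1, Real.exp_sum]
    simp only [exp_mul_edge t (edge_eq_zero_or_one ω N _ _) (bond_sq x _)]
    rw [Finset.prod_mul_distrib, relDensity]
    generalize (∏ e : Fin N × Fin N, (1 + edge ω N e.1 e.2 * (Real.cosh t - 1))) = F
    generalize (∏ e : Fin N × Fin N, (1 + edge ω N e.1 e.2 * (bond x e * Real.tanh t))) = G
    linear_combination (-F * G) * h2

theorem relDensity_pos (β : ℝ) (p : ℕ → unitInterval) (ω : GraphSeq) (N : ℕ) (c : ℝ)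
    (x : Config N) : 0 < relDensity β N c (Real.tanh (β / (2 * N * p N))) x ω := by
  obtain ⟨K, hK, h⟩ := exists_exp_exponentBG_eq β p ω N c
  have h1 := h x ▸ Real.exp_pos (exponentBG β p ω N x)
  exact (mul_pos_iff_of_pos_left (Real.exp_pos _)).1 ((mul_pos_iff_of_pos_left hK).1 h1)

theorem average_exponentBG_eq (β : ℝ) (p : ℕ → unitInterval) (ω : GraphSeq) (N : ℕ) (c : ℝ)
    (f : Config N → ℝ) :
    (∑ x, f x * Real.exp (exponentBG β p ω N x)) / ∑ x, Real.exp (exponentBG β p ω N x) =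
      (∑ x, f x * (cwWeight β N x * relDensity β N c (Real.tanh (β / (2 * N * p N))) x ω)) /
        ∑ x, cwWeight β N x * relDensity β N c (Real.tanh (β / (2 * N * p N))) x ω := by
  obtain ⟨K, hK, h⟩ := exists_exp_exponentBG_eq β p ω N c
  set Z := ∑ y : Config N, Real.exp (exponentCW β N y) with hZ
  have hZ0 : 0 < Z := sum_exp_pos _
  have h' : ∀ x, Real.exp (exponentBG β p ω N x) = K * Z * (cwWeight β N x *
      relDensity β N c (Real.tanh (β / (2 * N * p N))) x ω) := by
    intro x
    rw [h x, cwWeight, ← hZ]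
    field_simp
  simp only [h', mul_left_comm _ (K * Z), ← Finset.mul_sum]
  exact mul_div_mul_left _ _ (mul_pos hK hZ0).ne'

theorem integral_relDensity (β : ℝ) (p : ℕ → unitInterval) (N : ℕ) (c τ : ℝ) (x : Config N) :
    Integrable (relDensity β N c τ x) (graphLaw p) ∧
      ∫ ω, relDensity β N c τ x ω ∂graphLaw p =
        Real.exp (c ^ 2 / 2 - exponentCW β N x) *
          ∏ e : Fin N × Fin N, (1 + (p N : ℝ) * τ * bond x e) := by
  refine ⟨(integrable_prod_edge p N (fun e a => 1 + a * (bond x e * τ))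
    fun e => by fun_prop).const_mul _, ?_⟩
  simp only [relDensity]
  rw [integral_const_mul, integral_prod_edge p N (fun e a => 1 + a * (bond x e * τ))]
  congr 1
  exact Finset.prod_congr rfl fun e _ => by ring

theorem integral_relDensity_mul (β : ℝ) (p : ℕ → unitInterval) (N : ℕ) (c τ : ℝ)
    (x y : Config N) :
    Integrable (fun ω => relDensity β N c τ x ω * relDensity β N c τ y ω) (graphLaw p) ∧
      ∫ ω, relDensity β N c τ x ω * relDensity β N c τ y ω ∂graphLaw p =
        Real.exp (c ^ 2 / 2 - exponentCW β N x) * Real.exp (c ^ 2 / 2 - exponentCW β N y) *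
          ∏ e : Fin N × Fin N, (1 + ((p N : ℝ) * τ * (bond x e + bond y e) +
            (p N : ℝ) * τ ^ 2 * (bond x e * bond y e))) := by
  have h : (fun ω => relDensity β N c τ x ω * relDensity β N c τ y ω) = fun ω =>
      Real.exp (c ^ 2 / 2 - exponentCW β N x) * Real.exp (c ^ 2 / 2 - exponentCW β N y) *
        ∏ e : Fin N × Fin N, ((1 + edge ω N e.1 e.2 * (bond x e * τ)) *
          (1 + edge ω N e.1 e.2 * (bond y e * τ))) := by
    funext ω
    simp only [relDensity, Finset.prod_mul_distrib]
    ring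
  rw [h]
  refine ⟨(integrable_prod_edge p N (fun e a => (1 + a * (bond x e * τ)) *
    (1 + a * (bond y e * τ))) fun e => by fun_prop).const_mul _, ?_⟩
  rw [integral_const_mul, integral_prod_edge p N (fun e a => (1 + a * (bond x e * τ)) *
    (1 + a * (bond y e * τ)))]
  congr 1
  exact Finset.prod_congr rfl fun e _ => by ring

/-! ### The average distance of the moments from one -/

theorem exp_sub_one_le_of_le_half {δ l G : ℝ} (hδ : 0 ≤ δ) (hl : 0 < l) (h : δ ≤ l / 2)
    (hG : 0 ≤ G) : Real.exp (δ * G) - 1 ≤ 2 * δ / l * Real.exp (l * G) := by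
  have h1 : Real.exp (δ * G) - 1 ≤ δ * G * Real.exp (δ * G) := by
    have h2 := Real.add_one_le_exp (-(δ * G))
    have h3 := mul_le_mul_of_nonneg_right h2 (Real.exp_pos (δ * G)).le
    rw [← Real.exp_add, neg_add_cancel, Real.exp_zero] at h3
    linarith
  have h4 : l / 2 * G ≤ Real.exp (l / 2 * G) := by
    have := Real.add_one_le_exp (l / 2 * G)
    linarith
  have h5 : Real.exp (δ * G) ≤ Real.exp (l / 2 * G) :=
    Real.exp_le_exp.2 (mul_le_mul_of_nonneg_right h hG)
  calc _ ≤ δ * G * Real.exp (δ * G) := h1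
    _ = 2 * δ / l * ((l / 2 * G) * Real.exp (δ * G)) := by field_simp
    _ ≤ 2 * δ / l * (Real.exp (l / 2 * G) * Real.exp (l / 2 * G)) := by gcongr
    _ = _ := by rw [← Real.exp_add]; ring_nf

theorem momentDefect_relDensity_le (β : ℝ) (p : ℕ → unitInterval) {N : ℕ} (hN : 0 < N)
    {τ c r l C : ℝ} (hc : c = N * p N * τ) (hr : r = N * p N * τ ^ 2)
    (hcr : (2 * |c| + |r|) / N ≤ 1 / 2) (hl : 0 < l) (hδ : momentRate β N c r ≤ l / 2)
    (hC : ∑ x : Config N, ∑ y : Config N, cwWeight β N x * cwWeight β N y *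
        Real.exp (l * overlapSum x y) ≤ C) :
    momentDefect (graphLaw p) (cwWeight β N) (relDensity β N c τ) ≤
      6 * momentRate β N c r / l * C := by
  have hN' : (0 : ℝ) < N := by exact_mod_cast hN
  have hc' : (p N : ℝ) * τ = c / N := by rw [hc]; field_simp
  have hr' : (p N : ℝ) * τ ^ 2 = r / N := by rw [hr]; field_simp
  set δ := momentRate β N c r with hδdef
  have hδ0 : 0 ≤ δ := momentRate_nonneg β N c r
  have hpt : ∀ x y : Config N, cwWeight β N x * cwWeight β N y *
      (|∫ ω, relDensity β N c τ x ω * relDensity β N c τ y ω ∂graphLaw p - 1| +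
        |∫ ω, relDensity β N c τ x ω ∂graphLaw p - 1| +
        |∫ ω, relDensity β N c τ y ω ∂graphLaw p - 1|) ≤
      6 * δ / l * (cwWeight β N x * cwWeight β N y * Real.exp (l * overlapSum x y)) := by
    intro x y
    rw [(integral_relDensity_mul β p N c τ x y).2, (integral_relDensity β p N c τ x).2,
      (integral_relDensity β p N c τ y).2, hc', hr']
    have h2 := abs_second_moment_sub_one_le β hN hcr x y
    have h1 := abs_first_moment_sub_one_le β hN hcr x y
    have h1' := abs_first_moment_sub_one_le β hN hcr y x
    have hsymm : overlapSum y x = overlapSum x y := by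
      rw [overlapSum, overlapSum, mul_comm y x]; ring
    rw [hsymm] at h1'
    have h3 := exp_sub_one_le_of_le_half hδ0 hl hδ (zero_le_one.trans (one_le_overlapSum x y))
    have h4 := (add_le_add (add_le_add h2 h1) h1').trans
      (by linarith : _ ≤ 3 * (2 * δ / l * Real.exp (l * overlapSum x y)))
    have hw := mul_pos (cwWeight_pos β N x) (cwWeight_pos β N y)
    calc _ ≤ cwWeight β N x * cwWeight β N y *
          (3 * (2 * δ / l * Real.exp (l * overlapSum x y))) :=
          mul_le_mul_of_nonneg_left h4 hw.le
      _ = _ := by ring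
  rw [momentDefect]
  refine (Finset.sum_le_sum fun x _ => Finset.sum_le_sum fun y _ => hpt x y).trans ?_
  simp only [← Finset.mul_sum]
  exact mul_le_mul_of_nonneg_left hC (by positivity)

/-! ### Limits as the graphs grow -/

section Limits

variable {β : ℝ} {p : ℕ → unitInterval}

theorem tendsto_coupling (β : ℝ)
    (hNp : Tendsto (fun N : ℕ => (N : ℝ) * (p N : ℝ)) atTop atTop) :
    Tendsto (fun N : ℕ => β / (2 * N * p N)) atTop (𝓝 0) := by
  have h := (tendsto_const_nhds (x := β / 2)).div_atTop hNp
  refine h.congr fun N => ?_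
  rw [div_div, mul_assoc]

theorem tendsto_tanh_coupling (β : ℝ)
    (hNp : Tendsto (fun N : ℕ => (N : ℝ) * (p N : ℝ)) atTop atTop) :
    Tendsto (fun N : ℕ => Real.tanh (β / (2 * N * p N))) atTop (𝓝 0) := by
  have hcont : Continuous Real.tanh := by
    have : Real.tanh = fun x => Real.sinh x / Real.cosh x :=
      funext Real.tanh_eq_sinh_div_cosh
    rw [this]
    exact Real.continuous_sinh.div Real.continuous_cosh fun x => (Real.cosh_pos x).ne'
  have := (hcont.tendsto 0).comp (tendsto_coupling β hNp)
  rwa [Real.tanh_zero] at this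

/-- The effective coupling: `tanh t / t → 1` as `t = β / (2Np) → 0`. -/
theorem tendsto_mul_tanh_coupling (β : ℝ)
    (hNp : Tendsto (fun N : ℕ => (N : ℝ) * (p N : ℝ)) atTop atTop) :
    Tendsto (fun N : ℕ => (N : ℝ) * p N * Real.tanh (β / (2 * N * p N))) atTop (𝓝 (β / 2)) := by
  have hd : ContinuousAt (fun t => dslope Real.sinh 0 t / Real.cosh t) 0 :=
    (continuousAt_dslope_same.2 (Real.hasDerivAt_sinh 0).differentiableAt).div
      Real.continuous_cosh.continuousAt (Real.cosh_pos 0).ne'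
  have h1 := (hd.tendsto.comp (tendsto_coupling β hNp)).const_mul (β / 2)
  rw [dslope_same, (Real.hasDerivAt_sinh 0).deriv, div_self (Real.cosh_pos 0).ne', mul_one] at h1
  refine h1.congr' ?_
  filter_upwards [hNp.eventually_gt_atTop 0] with N hN
  have h2 := sub_smul_dslope Real.sinh 0 (β / (2 * N * p N))
  rw [Real.sinh_zero, sub_zero, sub_zero, smul_eq_mul] at h2
  have h3 : (N : ℝ) * p N * (β / (2 * N * p N)) = β / 2 := by
    have : β / (2 * N * p N) = β / 2 / (N * p N) := by rw [div_div, mul_assoc]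
    rw [this, mul_div_cancel₀ _ hN.ne']
  rw [Real.tanh_eq_sinh_div_cosh, ← h2, Function.comp_apply, ← h3]
  ring

theorem tendsto_momentRate (β : ℝ) {c r : ℕ → ℝ} (hc : Tendsto c atTop (𝓝 (β / 2)))
    (hr : Tendsto r atTop (𝓝 0)) :
    Tendsto (fun N => (2 * |c N| + |r N|) / (N : ℝ)) atTop (𝓝 0) ∧
      Tendsto (fun N => momentRate β N (c N) (r N)) atTop (𝓝 0) := by
  have hN := tendsto_natCast_atTop_atTop (R := ℝ)
  have hs : Tendsto (fun N => 2 * |c N| + |r N|) atTop (𝓝 (2 * |β / 2| + |0|)) :=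
    (hc.abs.const_mul 2).add hr.abs
  refine ⟨hs.div_atTop hN, ?_⟩
  have h1 : Tendsto (fun N => |c N - β / 2|) atTop (𝓝 0) := by
    simpa using (hc.sub_const (β / 2)).abs
  have h2 : Tendsto (fun N => |r N|) atTop (𝓝 0) := by simpa using hr.abs
  have h3 : Tendsto (fun N => c N ^ 2 / (N : ℝ)) atTop (𝓝 0) := (hc.pow 2).div_atTop hN
  have h4 : Tendsto (fun N => |c N| * |r N| / (N : ℝ)) atTop (𝓝 0) :=
    (hc.abs.mul hr.abs).div_atTop hN
  have h5 : Tendsto (fun N => r N ^ 2) atTop (𝓝 0) := by simpa using hr.pow 2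
  have h6 : Tendsto (fun N => 2 * (2 * |c N| + |r N|) ^ 3 / (N : ℝ)) atTop (𝓝 0) :=
    ((hs.pow 3).const_mul 2).div_atTop hN
  simpa [momentRate] using ((((h1.add h2).add h3).add h4).add h5).add h6

/-- The moments of the relative density converge to `1` on Curie-Weiss average. -/
theorem tendsto_momentDefect_relDensity (hβ : β < 1)
    (hNp : Tendsto (fun N : ℕ => (N : ℝ) * (p N : ℝ)) atTop atTop) :
    Tendsto (fun N : ℕ => momentDefect (graphLaw p) (cwWeight β N)
      (relDensity β N (N * p N * Real.tanh (β / (2 * N * p N)))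
        (Real.tanh (β / (2 * N * p N))))) atTop (𝓝 0) := by
  set τ : ℕ → ℝ := fun N => Real.tanh (β / (2 * N * p N)) with hτ
  set c : ℕ → ℝ := fun N => N * p N * τ N with hc
  set r : ℕ → ℝ := fun N => N * p N * τ N ^ 2 with hr
  have hclim : Tendsto c atTop (𝓝 (β / 2)) := tendsto_mul_tanh_coupling β hNp
  have hrlim : Tendsto r atTop (𝓝 0) := by
    have h := hclim.mul (tendsto_tanh_coupling β hNp)
    rw [mul_zero] at h
    refine h.congr fun N => ?_
    simp only [hc, hr, hτ]
    ring
  obtain ⟨hsmall, hrate⟩ := tendsto_momentRate β hclim hrlim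
  obtain ⟨l, hl, C, hC⟩ := exists_sum_exp_overlapSum_le hβ
  have hbound : Tendsto (fun N => 6 * momentRate β N (c N) (r N) / l * C) atTop (𝓝 0) := by
    simpa using ((hrate.const_mul 6).div_const l).mul_const C
  refine squeeze_zero' (.of_forall fun N => ?_) ?_ hbound
  · exact Finset.sum_nonneg fun x _ => Finset.sum_nonneg fun y _ =>
      mul_nonneg (mul_nonneg (cwWeight_pos β N x).le (cwWeight_pos β N y).le) (by positivity)
  · filter_upwards [eventually_gt_atTop 0,
      hsmall.eventually_le_const (by norm_num : (0 : ℝ) < 1 / 2),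
      hrate.eventually_le_const (half_pos hl)] with N hN h1 h2
    exact momentDefect_relDensity_le β p hN rfl rfl h1 hl h2 (hC N hN)

theorem tendstoInMeasure_integral_lawBG (hβ : β < 1)
    (hNp : Tendsto (fun N : ℕ => (N : ℝ) * (p N : ℝ)) atTop atTop) {d : ℕ}
    {Y : ∀ N : ℕ, Config N → EuclideanSpace ℝ (Fin d)}
    {PY : ProbabilityMeasure (EuclideanSpace ℝ (Fin d))}
    (hY : Tendsto (fun N : ℕ => lawCW β (Y N)) atTop (𝓝 PY))
    (f : BoundedContinuousFunction (EuclideanSpace ℝ (Fin d)) ℝ) :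
    TendstoInMeasure (graphLaw p)
      (fun N ω => ∫ y, f y ∂(lawBG β p ω (Y N) : Measure (EuclideanSpace ℝ (Fin d)))) atTop
      (fun _ => ∫ y, f y ∂(PY : Measure (EuclideanSpace ℝ (Fin d)))) := by
  rw [tendstoInMeasure_iff_measureReal_dist]
  intro ε hε
  have hCW := ProbabilityMeasure.tendsto_iff_forall_integral_tendsto.1 hY f
  have hbound : Tendsto (fun N : ℕ => 4 * ‖f‖ ^ 2 * momentDefect (graphLaw p) (cwWeight β N)
      (relDensity β N (N * p N * Real.tanh (β / (2 * N * p N)))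
        (Real.tanh (β / (2 * N * p N)))) / (ε / 2) ^ 2) atTop (𝓝 0) := by
    simpa using ((tendsto_momentDefect_relDensity hβ hNp).const_mul
      (4 * ‖f‖ ^ 2)).div_const ((ε / 2) ^ 2)
  refine squeeze_zero' (.of_forall fun N => measureReal_nonneg) ?_ hbound
  filter_upwards [Metric.tendsto_nhds.1 hCW _ (half_pos hε)] with N hN
  refine (measureReal_mono fun ω hω => ?_).trans (measure_le_abs_weighted_average_sub_le
    (fun x => (cwWeight_pos β N x).le) (sum_cwWeight β N)
    (fun x => (integral_relDensity β p N _ _ x).1)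
    (fun x y => (integral_relDensity_mul β p N _ _ x y).1)
    (fun ω => Finset.sum_pos (fun x _ => mul_pos (cwWeight_pos β N x)
      (relDensity_pos β p ω N _ x)) Finset.univ_nonempty)
    (fun x ω => (relDensity_pos β p ω N _ x).le)
    (f := fun x => f (Y N x)) (fun x => f.norm_coe_le_norm (Y N x)) (half_pos hε))
  rw [Set.mem_ofPred_eq] at hω ⊢
  rw [Real.dist_eq, lawCW, integral_imageLaw_gibbs _ _ f.continuous] at hN
  rw [Real.dist_eq, lawBG, integral_imageLaw_gibbs _ _ f.continuous,
    average_exponentBG_eq β p ω N (N * p N * Real.tanh (β / (2 * N * p N)))] at hω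
  have hw : ∑ x, f (Y N x) * cwWeight β N x =
      (∑ x, f (Y N x) * Real.exp (exponentCW β N x)) / ∑ x, Real.exp (exponentCW β N x) := by
    rw [Finset.sum_div]
    exact Finset.sum_congr rfl fun x _ => by rw [cwWeight, mul_div_assoc]
  rw [hw]
  have := abs_sub_le ((∑ x, f (Y N x) * (cwWeight β N x *
    relDensity β N (N * p N * Real.tanh (β / (2 * N * p N)))
      (Real.tanh (β / (2 * N * p N))) x ω)) / ∑ x, cwWeight β N x *
    relDensity β N (N * p N * Real.tanh (β / (2 * N * p N)))
      (Real.tanh (β / (2 * N * p N))) x ω)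
    ((∑ x, f (Y N x) * Real.exp (exponentCW β N x)) / ∑ x, Real.exp (exponentCW β N x))
    (∫ y, f y ∂(PY : Measure (EuclideanSpace ℝ (Fin d))))
  linarith

end Limits

end CurieWeiss

open CurieWeiss in
theorem theorem1 (β : ℝ) (hβ : β < 1) (p : ℕ → unitInterval) (hp : ∀ N, 0 < p N)
    (hNp : Tendsto (fun N : ℕ => (N : ℝ) * (p N : ℝ)) atTop atTop)
    (d : ℕ) (Y : ∀ N : ℕ, Config N → EuclideanSpace ℝ (Fin d))
    (PY : ProbabilityMeasure (EuclideanSpace ℝ (Fin d)))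
    (hY : Tendsto (fun N : ℕ => lawCW β (Y N)) atTop (𝓝 PY)) :
    TendstoInMeasure (graphLaw p)
      (fun (N : ℕ) (ω : GraphSeq) =>
        levyProkhorovDist (lawBG β p ω (Y N) : Measure (EuclideanSpace ℝ (Fin d)))
          (PY : Measure (EuclideanSpace ℝ (Fin d))))
      atTop (fun _ => (0 : ℝ)) ∧
    TendstoInMeasure (graphLaw p)
      (fun (N : ℕ) (ω : GraphSeq) =>
        levyDist (lawBG β p ω (Y N) : Measure (EuclideanSpace ℝ (Fin d)))
          (PY : Measure (EuclideanSpace ℝ (Fin d))))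
      atTop (fun _ => (0 : ℝ)) := by
  have hle : inProbability (graphLaw p) (fun N ω => lawBG β p ω (Y N)) ≤ 𝓝 PY :=
    inProbability_le_nhds fun f => tendstoInMeasure_integral_lawBG hβ hNp hY f
  exact ⟨tendsto_inProbability_iff.1 ((tendsto_levyProkhorovDist_nhds PY).mono_left hle),
    tendsto_inProbability_iff.1 ((tendsto_levyDist_nhds PY).mono_left hle)⟩
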